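/- **Generic polynomials.** Let $S$ be a finite set of primes and $G$ a finite group. A polynomial $P\in\mathbb{Q}(t_1,\dots,t_m)[x]$, where $t_1,\dots,t_m$ are indeterminates, is called *generic outside $S$ with group $G$* if 1. the Galois group of the splitting field of $P$ over $\mathbb{Q}(t_1,\dots,t_m)$ is isomorphic to $G$; 2. for every prime $p\notin S$ the reduction of $P$ modulo $p$ is defined (the coefficients of $P$ have a common denominator in $\mathbb{Z}[t_1,\dots,t_m]$ that is nonzero modulo $p$), it is separable and irreducible over $\mathbb{F}_p(t_1,\dots,t_m)$, and the Galois group of its splitting field over $\mathbb{F}_p(t_1,\dots,t_m)$ is isomorphic to $G$; 3. for every field $K$ of characteristic $0$ and every finite Galois extension $L/K$ with Galois group isomorphic to $G$, there are $\tau_1,\dots,\tau_m\in K$ such that the specialization $t_i\mapsto\tau_i$ of $P$ is defined (the coefficients of $P$ have a common denominator not vanishing at $\tau$) and $L$ is the splitting field over $K$ of the specialized polynomial; 4. for every prime $p\notin S$, every field $K$ of characteristic $p$ and every finite Galois extension $L/K$ with Galois group isomorphic to $G$, there are $\tau_1,\dots,\tau_m\in K$ such that the specialization $t_i\mapsto\tau_i$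 of the reduction of $P$ modulo $p$ is defined and $L$ is the splitting field over $K$ of the resulting polynomial. **Theorem.** The following two polynomials are generic outside $\{2,3,5\}$ with group $S_5$. (a) The quintic in $z$ with the three indeterminate parameters $A,\Delta,M$: $$\begin{aligned} &288M^2z^5\\ &+(279890625\Delta^2A^2+262154475\Delta A^4-3666000MA\Delta-2041200MA^3+59541075A^6+87890625\Delta^3+14880M^2)z^4\\ &+(3711849300\Delta A^4+6170437500\Delta^2A^2-83428000MA\Delta-23781600MA^3+538658100A^6-351562500\Delta^3+259520M^2)z^3\\ &+(15376579650\Delta A^4+22131843750\Delta^2A^2-372984000MA\Delta-130420800MA^3+2685964050A^6+527343750\Delta^3+1583040M^2)z^2\\ &+(9952607700\Delta A^4+15161437500\Delta^2A^2-243612000MA\Delta-79322400MA^3+1619910900A^6-351562500\Delta^3+971040M^2)z\\ &-42806000MA\Delta+1743266475\Delta A^4+2912390625\Delta^2A^2+157216M^2-12805200MA^3+260745075A^6+87890625\Delta^3 . \end{aligned}$$ (b) The quintic in $u$ with the two indeterminate parameters $\delta,q$: $$\begin{aligned} &u^2(u+50)^3\\ &-20\,(611\delta u^3+8505u^3+39270\delta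 u^2+263250u^2+4050000u+438000\delta u+100000\delta)\,u\,q\\ &+2(25+3\delta)\,(625\delta^2u^4+44550\delta u^4+793881u^4+18370800u^3+3175200\delta u^3-10000\delta^2u^3\\ &\qquad+262440000u^2+60000\delta^2u^2+25336800\delta u^2-160000\delta^2u+12960000\delta u+160000\delta^2)\,q^2 . \end{aligned}$$ -/

import Mathlib

open Polynomial

universe u v w

/-- The field `k(t₁, …, tₘ)` of rational functions in `m` independent parameters. -/
abbrev ParamField (k : Type u) [Field k] (m : ℕ) : Type u :=
  FractionRing (MvPolynomial (Fin m) k)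

/-- The parameter `tᵢ` as an element of `k(t₁, …, tₘ)`. -/
noncomputable def param (k : Type u) [Field k] {m : ℕ} (i : Fin m) : ParamField k m :=
  algebraMap (MvPolynomial (Fin m) k) (ParamField k m) (MvPolynomial.X i)

/-- `Q ∈ K[x]` is obtained from `P ∈ k(t₁, …, tₘ)[x]` by specializing the parameters to
`τ₁, …, τₘ ∈ K`, the constants being mapped to `K` by `φ`.  The coefficients of `P` have a common
denominator `d` that does not vanish at `τ`; such a `Q` is unique. -/
def IsSpecialization {k : Type u} {K : Type v} [Field k] [Field K] {m : ℕ} (φ : k →+* K)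
    (P : (ParamField k m)[X]) (τ : Fin m → K) (Q : K[X]) : Prop :=
  ∃ (d : MvPolynomial (Fin m) k) (N : (MvPolynomial (Fin m) k)[X]),
    MvPolynomial.eval₂Hom φ τ d ≠ 0 ∧
    C (algebraMap (MvPolynomial (Fin m) k) (ParamField k m) d) * P =
      N.map (algebraMap (MvPolynomial (Fin m) k) (ParamField k m)) ∧
    C (MvPolynomial.eval₂Hom φ τ d) * Q = N.map (MvPolynomial.eval₂Hom φ τ)

/-- The ring homomorphism `ℤ[t₁, …, tₘ] → k(t₁, …, tₘ)`; over `𝔽_p` it is reduction modulo `p`. -/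
noncomputable def intParamHom (k : Type u) [Field k] (m : ℕ) :
    MvPolynomial (Fin m) ℤ →+* ParamField k m :=
  (algebraMap (MvPolynomial (Fin m) k) (ParamField k m)).comp
    (MvPolynomial.map (Int.castRingHom k))

/-- The reduction modulo `p` of `P ∈ ℚ(t₁, …, tₘ)[x]` is defined and equals
`Q ∈ 𝔽_p(t₁, …, tₘ)[x]`: the coefficients of `P` have a common denominator `d ∈ ℤ[t₁, …, tₘ]` that
is nonzero modulo `p`.  Such a `Q` is unique. -/
def IsReductionMod (p : ℕ) [Fact p.Prime] {m : ℕ} (P : (ParamField ℚ m)[X])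
    (Q : (ParamField (ZMod p) m)[X]) : Prop :=
  ∃ (d : MvPolynomial (Fin m) ℤ) (N : (MvPolynomial (Fin m) ℤ)[X]),
    intParamHom (ZMod p) m d ≠ 0 ∧
    C (intParamHom ℚ m d) * P = N.map (intParamHom ℚ m) ∧
    C (intParamHom (ZMod p) m d) * Q = N.map (intParamHom (ZMod p) m)

/-- `P ∈ ℚ(t₁, …, tₘ)[x]` is a generic polynomial with group `G` outside the set `S` of primes. -/
structure IsGenericOutside (S : Finset ℕ) (G : Type w) [Group G] {m : ℕ}
    (P : (ParamField ℚ m)[X]) : Prop where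
  /-- The Galois group of `P` over `ℚ(t₁, …, tₘ)` is `G`. -/
  gal : Nonempty (P.Gal ≃* G)
  /-- For a prime `p ∉ S` the reduction of `P` modulo `p` is defined, separable and irreducible,
  and has Galois group `G` over `𝔽_p(t₁, …, tₘ)`. -/
  gal_mod : ∀ (p : ℕ) [Fact p.Prime], p ∉ S →
    ∃ Q : (ParamField (ZMod p) m)[X], IsReductionMod p P Q ∧
      Q.Separable ∧ Irreducible Q ∧ Nonempty (Q.Gal ≃* G)
  /-- Every Galois extension with group `G` in characteristic zero is the splitting field of a
  specialization of `P`. -/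
  param_char_zero : ∀ (K : Type u) (L : Type v) [Field K] [CharZero K] [Field L] [Algebra K L]
    [FiniteDimensional K L] [IsGalois K L], Nonempty ((L ≃ₐ[K] L) ≃* G) →
    ∃ (τ : Fin m → K) (R : K[X]),
      IsSpecialization (algebraMap ℚ K) P τ R ∧ R.IsSplittingField K L
  /-- Every Galois extension with group `G` in characteristic `p ∉ S` is the splitting field of a
  specialization of the reduction of `P` modulo `p`. -/
  param_char_p : ∀ (p : ℕ) [Fact p.Prime], p ∉ S →
    ∀ (K : Type u) (L : Type v) [Field K] [CharP K p] [Field L] [Algebra K L]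
      [FiniteDimensional K L] [IsGalois K L], Nonempty ((L ≃ₐ[K] L) ≃* G) →
    ∃ (Q : (ParamField (ZMod p) m)[X]) (τ : Fin m → K) (R : K[X]),
      IsReductionMod p P Q ∧ IsSpecialization (ZMod.castHom (dvd_refl p) K) Q τ R ∧
      R.IsSplittingField K L

/-- The first quintic, in the variable `z`, with parameters `A`, `Δ`, `M`. -/
noncomputable def quinticZ {R : Type u} [CommRing R] (A Δ M : R) : R[X] :=
  C (288 * M ^ 2) * X ^ 5
  + C (279890625 * Δ ^ 2 * A ^ 2 + 262154475 * Δ * A ^ 4 - 3666000 * M * A * Δ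
      - 2041200 * M * A ^ 3 + 59541075 * A ^ 6 + 87890625 * Δ ^ 3 + 14880 * M ^ 2) * X ^ 4
  + C (3711849300 * Δ * A ^ 4 + 6170437500 * Δ ^ 2 * A ^ 2 - 83428000 * M * A * Δ
      - 23781600 * M * A ^ 3 + 538658100 * A ^ 6 - 351562500 * Δ ^ 3 + 259520 * M ^ 2) * X ^ 3
  + C (15376579650 * Δ * A ^ 4 + 22131843750 * Δ ^ 2 * A ^ 2 - 372984000 * M * A * Δ
      - 130420800 * M * A ^ 3 + 2685964050 * A ^ 6 + 527343750 * Δ ^ 3 + 1583040 * M ^ 2) * X ^ 2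
  + C (9952607700 * Δ * A ^ 4 + 15161437500 * Δ ^ 2 * A ^ 2 - 243612000 * M * A * Δ
      - 79322400 * M * A ^ 3 + 1619910900 * A ^ 6 - 351562500 * Δ ^ 3 + 971040 * M ^ 2) * X
  + C (-42806000 * M * A * Δ + 1743266475 * Δ * A ^ 4 + 2912390625 * Δ ^ 2 * A ^ 2
      + 157216 * M ^ 2 - 12805200 * M * A ^ 3 + 260745075 * A ^ 6 + 87890625 * Δ ^ 3)

/-- The second quintic, in the variable `u`, with parameters `δ`, `q`. -/
noncomputable def quinticU {R : Type u} [CommRing R] (δ q : R) : R[X] :=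
  X ^ 2 * (X + 50) ^ 3
  - 20 * (C (611 * δ) * X ^ 3 + 8505 * X ^ 3 + C (39270 * δ) * X ^ 2 + 263250 * X ^ 2
      + 4050000 * X + C (438000 * δ) * X + C (100000 * δ)) * X * C q
  + 2 * C (25 + 3 * δ) * (C (625 * δ ^ 2) * X ^ 4 + C (44550 * δ) * X ^ 4 + 793881 * X ^ 4
      + 18370800 * X ^ 3 + C (3175200 * δ) * X ^ 3 - C (10000 * δ ^ 2) * X ^ 3
      + 262440000 * X ^ 2 + C (60000 * δ ^ 2) * X ^ 2 + C (25336800 * δ) * X ^ 2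
      - C (160000 * δ ^ 2) * X + C (12960000 * δ) * X + C (160000 * δ ^ 2)) * C q ^ 2

/-!
Let `L / K` be a Galois extension with group `S₅` in characteristic different from `2`, `3`, `5`,
and let `y₁, …, y₅` be conjugate elements of `L` permuted by the group in the standard way,
regarded as the roots of a binary quintic form `F`. The invariants `A`, `B`, `C` of `F` of degrees
4, 8 and 12, with `D = A² - 128 B` and `M = A³ - 2 A B + 3 C`, give elements `δ = D / (5 A²)` and
`q = 25 A³ / (8192 M)` of `K`. Move the root `yᵢ` to `(0 : 1)` by a substitution `x ↦ x + yᵢ y`.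
Then `uᵢ = resNum / resDen ^ 2`, a rational function of the new coefficients, is a root of
`quinticU δ q`: neither this function nor the invariants change under `y ↦ y + s x`, so that the
coefficient of `x² y³` may be assumed to vanish, and there the claim is a polynomial identity
(`BinaryQuintic.eval_quinticU_of_depressed`, `BinaryQuintic.resDen_ne_zero_and_root`). The `uᵢ`
are permuted like the `yᵢ`. A Tschirnhaus transformation over the infinite field `K` makes the
denominators nonzero and the `uᵢ` distinct, since the polynomial `BinaryQuintic.genericity` does
not vanish identically. So `L` is the splitting field of `quinticU δ q` (`exists_quinticU_roots`).
The substitution `u = 3 z + 1` turns this quintic into a specialization of `quinticZ`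
(`aeval_quinticZ_of_quinticU`).

The Galois groups of the two polynomials follow from their parametrization property
(`ParametrizesPerm.isGenericOutside`). Over every field `k` of characteristic different from
`2`, `3`, `5` the extension `k(x₁, …, x₅)` of the field of symmetric rational functions has group
`S₅`, hence it comes from a specialization of the polynomial. A
specialization that preserves the degree and the distinctness of the roots cannot have a larger
group than the polynomial itself (`gal_of_specialization`): extend the specialization to the
integral closure in a splitting field; a lift of an automorphism of the specialized roots differs
from this extension by an automorphism of the splitting field.
-/

/-! ### Binary quintic forms and their invariants -/

/-- A binary quintic form
`c₀ x⁵ + 5 c₁ x⁴ y + 10 c₂ x³ y² + 10 c₃ x² y³ + 5 c₄ x y⁴ + c₅ y⁵`, given by its coefficients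
divided by the binomial coefficients. -/
@[ext]
structure BinaryQuintic (R : Type*) where
  (c0 c1 c2 c3 c4 c5 : R)

namespace BinaryQuintic

variable {R S : Type*} [CommRing R] [CommRing S]

/-- The image of a binary quintic under a ring homomorphism. -/
def map (φ : R →+* S) (F : BinaryQuintic R) : BinaryQuintic S :=
  ⟨φ F.c0, φ F.c1, φ F.c2, φ F.c3, φ F.c4, φ F.c5⟩

/-- The form `F(x + s y, y)`. -/
def shift (s : R) (F : BinaryQuintic R) : BinaryQuintic R where
  c0 := F.c0
  c1 := F.c1 + s * F.c0
  c2 := F.c2 + 2 * s * F.c1 + s ^ 2 * F.c0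
  c3 := F.c3 + 3 * s * F.c2 + 3 * s ^ 2 * F.c1 + s ^ 3 * F.c0
  c4 := F.c4 + 4 * s * F.c3 + 6 * s ^ 2 * F.c2 + 4 * s ^ 3 * F.c1 + s ^ 4 * F.c0
  c5 := F.c5 + 5 * s * F.c4 + 10 * s ^ 2 * F.c3 + 10 * s ^ 3 * F.c2 + 5 * s ^ 4 * F.c1
    + s ^ 5 * F.c0

/-- The form `F(y, x)`. -/
def rev (F : BinaryQuintic R) : BinaryQuintic R := ⟨F.c5, F.c4, F.c3, F.c2, F.c1, F.c0⟩

/-- The coefficient of `x²` in the quadratic covariant `i = i₀ x² + i₁ x y + i₂ y²`, the fourth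
transvectant of `F` with itself up to a constant. -/
def i0 (F : BinaryQuintic R) : R := F.c0 * F.c4 - 4 * F.c1 * F.c3 + 3 * F.c2 ^ 2
/-- The coefficient of `x y` in the covariant `i`. -/
def i1 (F : BinaryQuintic R) : R := F.c0 * F.c5 - 3 * F.c1 * F.c4 + 2 * F.c2 * F.c3
/-- The coefficient of `y²` in the covariant `i`. -/
def i2 (F : BinaryQuintic R) : R := F.c1 * F.c5 - 4 * F.c2 * F.c4 + 3 * F.c3 ^ 2

/-- The coefficient of `x³` in the cubic covariant `j = j₀ x³ + 3 j₁ x² y + 3 j₂ x y² + j₃ y³`, the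
second transvectant of `F` with `i` up to a constant. -/
def j0 (F : BinaryQuintic R) : R := F.c0 * F.i2 - F.c1 * F.i1 + F.c2 * F.i0
/-- One third of the coefficient of `x² y` in the covariant `j`. -/
def j1 (F : BinaryQuintic R) : R := F.c1 * F.i2 - F.c2 * F.i1 + F.c3 * F.i0
/-- One third of the coefficient of `x y²` in the covariant `j`. -/
def j2 (F : BinaryQuintic R) : R := F.c2 * F.i2 - F.c3 * F.i1 + F.c4 * F.i0
/-- The coefficient of `y³` in the covariant `j`. -/
def j3 (F : BinaryQuintic R) : R := F.c3 * F.i2 - F.c4 * F.i1 + F.c5 * F.i0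

/-- The coefficient of `x²` in the quadratic covariant `t = t₀ x² + t₁ x y + t₂ y²`, the Hessian of
`j` up to a constant. -/
def t0 (F : BinaryQuintic R) : R := F.j0 * F.j2 - F.j1 ^ 2
/-- The coefficient of `x y` in the covariant `t`. -/
def t1 (F : BinaryQuintic R) : R := F.j0 * F.j3 - F.j1 * F.j2
/-- The coefficient of `y²` in the covariant `t`. -/
def t2 (F : BinaryQuintic R) : R := F.j1 * F.j3 - F.j2 ^ 2

/-- The invariant of degree 4, the discriminant of `i`. -/
def invA (F : BinaryQuintic R) : R := F.i1 ^ 2 - 4 * F.i0 * F.i2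
/-- The invariant of degree 8, the polar pairing of `i` with `t`. -/
def invB (F : BinaryQuintic R) : R := 2 * F.i0 * F.t2 - F.i1 * F.t1 + 2 * F.i2 * F.t0
/-- The invariant of degree 12, minus the discriminant of `t`. -/
def invC (F : BinaryQuintic R) : R := 4 * F.t0 * F.t2 - F.t1 ^ 2

/-- The discriminant of the quintic, up to a constant. -/
def invD (F : BinaryQuintic R) : R := F.invA ^ 2 - 128 * F.invB
/-- A second invariant of degree 12, the denominator of the parameter `q`. -/
def invM (F : BinaryQuintic R) : R := F.invA ^ 3 - 2 * F.invA * F.invB + 3 * F.invC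

section shift
variable (s : R) (F : BinaryQuintic R)

lemma i0_shift : (F.shift s).i0 = F.i0 := by simp only [i0, shift]; ring
lemma i1_shift : (F.shift s).i1 = F.i1 + 2 * s * F.i0 := by simp only [i0, i1, shift]; ring
lemma i2_shift : (F.shift s).i2 = F.i2 + s * F.i1 + s ^ 2 * F.i0 := by
  simp only [i0, i1, i2, shift]; ring

lemma j0_shift : (F.shift s).j0 = F.j0 := by
  simp only [j0, i0_shift, i1_shift, i2_shift]; simp only [shift]; ring
lemma j1_shift : (F.shift s).j1 = F.j1 + s * F.j0 := by
  simp only [j0, j1, i0_shift, i1_shift, i2_shift]; simp only [shift]; ring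
lemma j2_shift : (F.shift s).j2 = F.j2 + 2 * s * F.j1 + s ^ 2 * F.j0 := by
  simp only [j0, j1, j2, i0_shift, i1_shift, i2_shift]; simp only [shift]; ring
lemma j3_shift : (F.shift s).j3 = F.j3 + 3 * s * F.j2 + 3 * s ^ 2 * F.j1 + s ^ 3 * F.j0 := by
  simp only [j0, j1, j2, j3, i0_shift, i1_shift, i2_shift]; simp only [shift]; ring

lemma t0_shift : (F.shift s).t0 = F.t0 := by
  simp only [t0, j0_shift, j1_shift, j2_shift]; ring
lemma t1_shift : (F.shift s).t1 = F.t1 + 2 * s * F.t0 := by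
  simp only [t0, t1, j0_shift, j1_shift, j2_shift, j3_shift]; ring
lemma t2_shift : (F.shift s).t2 = F.t2 + s * F.t1 + s ^ 2 * F.t0 := by
  simp only [t0, t1, t2, j1_shift, j2_shift, j3_shift]; ring

lemma invA_shift : (F.shift s).invA = F.invA := by
  simp only [invA, i0_shift, i1_shift, i2_shift]; ring
lemma invB_shift : (F.shift s).invB = F.invB := by
  simp only [invB, i0_shift, i1_shift, i2_shift, t0_shift, t1_shift, t2_shift]; ring
lemma invC_shift : (F.shift s).invC = F.invC := by
  simp only [invC, t0_shift, t1_shift, t2_shift]; ring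

lemma i0_rev : F.rev.i0 = F.i2 := by simp only [i0, i2, rev]; ring
lemma i1_rev : F.rev.i1 = F.i1 := by simp only [i1, rev]; ring
lemma i2_rev : F.rev.i2 = F.i0 := by simp only [i0, i2, rev]; ring
lemma j0_rev : F.rev.j0 = F.j3 := by
  simp only [j0, j3, i0_rev, i1_rev, i2_rev]; simp only [rev]; ring
lemma j1_rev : F.rev.j1 = F.j2 := by
  simp only [j1, j2, i0_rev, i1_rev, i2_rev]; simp only [rev]; ring
lemma j2_rev : F.rev.j2 = F.j1 := by
  simp only [j2, j1, i0_rev, i1_rev, i2_rev]; simp only [rev]; ring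
lemma j3_rev : F.rev.j3 = F.j0 := by
  simp only [j3, j0, i0_rev, i1_rev, i2_rev]; simp only [rev]; ring
lemma invA_rev : F.rev.invA = F.invA := by simp only [invA, i0_rev, i1_rev, i2_rev]; ring
lemma invB_rev : F.rev.invB = F.invB := by
  simp only [invB, t0, t1, t2, i0_rev, i1_rev, i2_rev, j0_rev, j1_rev, j2_rev, j3_rev]; ring
lemma invC_rev : F.rev.invC = F.invC := by
  simp only [invC, t0, t1, t2, j0_rev, j1_rev, j2_rev, j3_rev]; ring

end shift

section field
variable {E : Type*} [Field E]

/-- The identity behind the parametrization: for a form with the root `(0 : 1)` and without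
`x² y³`-term, an explicit rational function of the coefficients is a root of `quinticU δ q`, where
`δ` and `q` are invariants of the form. -/
lemma eval_quinticU_of_depressed (h2 : (2 : E) ≠ 0) (h5 : (5 : E) ≠ 0) (F : BinaryQuintic E)
    (hc5 : F.c5 = 0) (hc3 : F.c3 = 0) (hc2 : F.c2 ≠ 0)
    (hA : F.invA ≠ 0) (hM : F.invM ≠ 0) :
    (quinticU (F.invD / (5 * F.invA ^ 2)) (25 * F.invA ^ 3 / (8192 * F.invM))).eval
      (-(5 * (3 * F.c0 * F.c4 + 5 * F.c2 ^ 2)) / (32 * F.c2 ^ 2)) = 0 := by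
  have h32 : (32 : E) ≠ 0 := by
    have : (32 : E) = 2 ^ 5 := by norm_num
    rw [this]; exact pow_ne_zero _ h2
  have h8 : (8192 : E) ≠ 0 := by
    have : (8192 : E) = 2 ^ 13 := by norm_num
    rw [this]; exact pow_ne_zero _ h2
  simp only [quinticU]
  simp only [eval_add, eval_sub, eval_mul, eval_pow, eval_X, eval_C, eval_ofNat]
  generalize hAe : F.invA = A at *
  generalize hMe : F.invM = M at *
  generalize hDe : F.invD = D at *
  field_simp
  subst hAe hMe hDe
  simp only [invD, invM, invA, invB, invC, t0, t1, t2, j0, j1, j2, j3, i0, i1, i2, hc5, hc3]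
  ring

lemma c2_ne_zero_of_depressed (F : BinaryQuintic E) (hc5 : F.c5 = 0) (hc3 : F.c3 = 0)
    (hM : F.invM ≠ 0) : F.c2 ≠ 0 := by
  intro hc2
  apply hM
  simp only [invM, invA, invB, invC, t0, t1, t2, j0, j1, j2, j3, i0, i1, i2, hc5, hc3, hc2]
  ring

/-- The numerator of the function `resNum F / resDen F ^ 2` of a form `F` with the root `(0 : 1)`.
This function is invariant under the substitutions `y ↦ y + s x`, which fix that root. -/
def resNum {R : Type*} [CommRing R] (F : BinaryQuintic R) : R :=
  -5 * F.c4 ^ 2 * (6 * F.c0 * F.c4 - 15 * F.c1 * F.c3 + 10 * F.c2 ^ 2)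

/-- The square root of the denominator of the function `resNum F / resDen F ^ 2`. -/
def resDen {R : Type*} [CommRing R] (F : BinaryQuintic R) : R :=
  2 * (4 * F.c2 * F.c4 - 3 * F.c3 ^ 2)

/-- The identity for an arbitrary form with the simple root `(0 : 1)`, by removing the
`x² y³`-term with a substitution `y ↦ y + s x`. -/
lemma resDen_ne_zero_and_root (h2 : (2 : E) ≠ 0) (h5 : (5 : E) ≠ 0) (F : BinaryQuintic E)
    (hc5 : F.c5 = 0) (hc4 : F.c4 ≠ 0) (hA : F.invA ≠ 0) (hM : F.invM ≠ 0) :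
    F.resDen ≠ 0 ∧
    (quinticU (F.invD / (5 * F.invA ^ 2)) (25 * F.invA ^ 3 / (8192 * F.invM))).eval
      (F.resNum / F.resDen ^ 2) = 0 := by
  obtain ⟨G, hG⟩ : ∃ G, G = (F.rev.shift (-F.c3 / (2 * F.c4))).rev := ⟨_, rfl⟩
  have eA : G.invA = F.invA := by rw [hG, invA_rev, invA_shift, invA_rev]
  have eB : G.invB = F.invB := by rw [hG, invB_rev, invB_shift, invB_rev]
  have eC : G.invC = F.invC := by rw [hG, invC_rev, invC_shift, invC_rev]
  have eD : G.invD = F.invD := by rw [invD, invD, eA, eB]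
  have eM : G.invM = F.invM := by rw [invM, invM, eA, eB, eC]
  have g5 : G.c5 = 0 := by rw [hG]; exact hc5
  have g4 : G.c4 = F.c4 := by
    rw [hG]; simp only [rev, shift, hc5]; ring
  have g3 : G.c3 = 0 := by
    rw [hG]; simp only [rev, shift, hc5]; field_simp; ring
  have g2 : 4 * F.c4 * G.c2 = 4 * F.c2 * F.c4 - 3 * F.c3 ^ 2 := by
    rw [hG]; simp only [rev, shift, hc5]; field_simp; ring
  have g0 : 6 * F.c0 * F.c4 - 15 * F.c1 * F.c3 + 10 * F.c2 ^ 2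
      = 6 * G.c0 * F.c4 + 10 * G.c2 ^ 2 := by
    rw [hG]; simp only [rev, shift, hc5]; field_simp; ring
  have h2' := c2_ne_zero_of_depressed G g5 g3 (eM ▸ hM)
  have h4 : (4 : E) ≠ 0 := by
    have : (4 : E) = 2 ^ 2 := by norm_num
    rw [this]; exact pow_ne_zero _ h2
  have hd : F.resDen ≠ 0 := by
    rw [resDen, ← g2]
    exact mul_ne_zero h2 (mul_ne_zero (mul_ne_zero h4 hc4) h2')
  refine ⟨hd, ?_⟩
  have key := eval_quinticU_of_depressed h2 h5 G g5 g3 h2' (eA ▸ hA) (eM ▸ hM)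
  rw [eA, eD, eM, g4] at key
  convert key using 2
  have h32 : (32 : E) ≠ 0 := by
    have : (32 : E) = 2 ^ 5 := by norm_num
    rw [this]; exact pow_ne_zero _ h2
  rw [resDen] at hd
  rw [resNum, resDen, g0, ← g2]
  field_simp
  ring

end field

end BinaryQuintic

/-! ### Forms with given roots -/

namespace BinaryQuintic

variable {R S : Type*} [CommRing R] [CommRing S]

section map
variable (φ : R →+* S) (F : BinaryQuintic R)

lemma map_shift (s : R) : (F.shift s).map φ = (F.map φ).shift (φ s) := by
  simp [map, shift, map_ofNat]

lemma invA_map : (F.map φ).invA = φ F.invA := by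
  simp [invA, i0, i1, i2, map, map_ofNat]

lemma invB_map : (F.map φ).invB = φ F.invB := by
  simp [invB, t0, t1, t2, j0, j1, j2, j3, i0, i1, i2, map, map_ofNat]

lemma invC_map : (F.map φ).invC = φ F.invC := by
  simp [invC, t0, t1, t2, j0, j1, j2, j3, i0, i1, i2, map, map_ofNat]

lemma invM_map : (F.map φ).invM = φ F.invM := by
  simp [invM, invA_map, invB_map, invC_map, map_ofNat]

lemma invD_map : (F.map φ).invD = φ F.invD := by
  simp [invD, invA_map, invB_map, map_ofNat]

lemma resNum_map : (F.map φ).resNum = φ F.resNum := by simp [resNum, map, map_ofNat]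

lemma resDen_map : (F.map φ).resDen = φ F.resDen := by simp [resDen, map, map_ofNat]

end map

/-- The form `10 ∏ᵢ (x - yᵢ y)`; the factor `10` clears the binomial coefficients. -/
def ofRoots (y : Fin 5 → R) : BinaryQuintic R where
  c0 := 10
  c1 := -2 * (y 0 + y 1 + y 2 + y 3 + y 4)
  c2 := y 0 * y 1 + y 0 * y 2 + y 0 * y 3 + y 0 * y 4 + y 1 * y 2 + y 1 * y 3 + y 1 * y 4
    + y 2 * y 3 + y 2 * y 4 + y 3 * y 4
  c3 := -(y 0 * y 1 * y 2 + y 0 * y 1 * y 3 + y 0 * y 1 * y 4 + y 0 * y 2 * y 3 + y 0 * y 2 * y 4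
    + y 0 * y 3 * y 4 + y 1 * y 2 * y 3 + y 1 * y 2 * y 4 + y 1 * y 3 * y 4 + y 2 * y 3 * y 4)
  c4 := 2 * (y 0 * y 1 * y 2 * y 3 + y 0 * y 1 * y 2 * y 4 + y 0 * y 1 * y 3 * y 4
    + y 0 * y 2 * y 3 * y 4 + y 1 * y 2 * y 3 * y 4)
  c5 := -10 * (y 0 * y 1 * y 2 * y 3 * y 4)

lemma ofRoots_map (φ : R →+* S) (y : Fin 5 → R) :
    (ofRoots y).map φ = ofRoots (fun i ↦ φ (y i)) := by
  simp [map, ofRoots, map_ofNat]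

lemma ofRoots_swap (y : Fin 5 → R) (i : Fin 5) :
    ofRoots (fun k ↦ y (Equiv.swap 0 i k)) = ofRoots y := by
  fin_cases i <;> ext <;> simp [ofRoots, Equiv.swap_apply_def] <;> ring

/-- The transpositions `(0 i)` generate, so `ofRoots_swap` gives all permutations. -/
lemma ofRoots_perm (π : Equiv.Perm (Fin 5)) : ∀ (y : Fin 5 → R),
    ofRoots (fun k ↦ y (π k)) = ofRoots y := by
  induction π using Equiv.Perm.swap_induction_on with
  | one => intro y; rfl
  | swap_mul f a b hab ih =>
    intro y
    refine (ih (fun k ↦ y (Equiv.swap a b k))).trans ?_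
    have h : Equiv.swap a b = Equiv.swap 0 a * Equiv.swap 0 b * Equiv.swap 0 a ∨ a = 0 ∨ b = 0 := by
      revert a b; decide
    rcases h with h | rfl | rfl
    · rw [h]
      simp only [Equiv.Perm.mul_apply]
      exact (ofRoots_swap (fun k ↦ y (Equiv.swap 0 a (Equiv.swap 0 b k))) a).trans
        ((ofRoots_swap (fun k ↦ y (Equiv.swap 0 a k)) b).trans (ofRoots_swap y a))
    · exact ofRoots_swap y b
    · rw [Equiv.swap_comm]; exact ofRoots_swap y a

lemma c5_shift_ofRoots (y : Fin 5 → R) (i : Fin 5) : ((ofRoots y).shift (y i)).c5 = 0 := by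
  fin_cases i <;> (simp [ofRoots, shift]; ring)

/-- A polynomial in the roots whose nonvanishing makes the parametrization work: the denominators
`invA` and `invM` are nonzero, `y 0` is a simple root, and the values of the function
`resNum / resDen ^ 2` at the roots `y 0` and `y 1` differ. -/
def genericity (y : Fin 5 → R) : R :=
  (ofRoots y).invA * (ofRoots y).invM * ((ofRoots y).shift (y 0)).c4
    * (((ofRoots y).shift (y 0)).resNum * ((ofRoots y).shift (y 1)).resDen ^ 2
      - ((ofRoots y).shift (y 1)).resNum * ((ofRoots y).shift (y 0)).resDen ^ 2)

lemma genericity_map (φ : R →+* S) (y : Fin 5 → R) :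
    genericity (fun i ↦ φ (y i)) = φ (genericity y) := by
  have hs (s : R) : ((ofRoots fun i ↦ φ (y i)).shift (φ s)) = ((ofRoots y).shift s).map φ := by
    rw [map_shift, ofRoots_map]
  have hc (F : BinaryQuintic R) : (F.map φ).c4 = φ F.c4 := rfl
  simp only [genericity, hs, resNum_map, resDen_map, hc]
  simp only [← ofRoots_map, invA_map, invM_map, map_mul, map_sub, map_pow]

/-- The form `10 x (x² - y²)²` shows that `genericity` does not vanish identically outside the
characteristics `2`, `3`, `5`. -/
lemma genericity_witness :
    genericity (![0, 1, 1, -1, -1] : Fin 5 → R) = -(2 ^ 51 * 3 ^ 6 * 5 ^ 4) := by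
  have : ofRoots (![0, 1, 1, -1, -1] : Fin 5 → R) = ⟨10, 0, -2, 0, 2, 0⟩ := by
    ext <;> simp [ofRoots] <;> norm_num
  simp only [genericity, this]
  simp [shift, resNum, resDen, invA, invM, invB, invC, t0, t1, t2, j0, j1, j2, j3, i0, i1, i2]
  norm_num

end BinaryQuintic

/-! ### Parametrization of extensions with group `S₅` -/

lemma quinticU_map {R S : Type*} [CommRing R] [CommRing S] (φ : R →+* S) (δ q : R) :
    (quinticU δ q).map φ = quinticU (φ δ) (φ q) := by
  simp [quinticU, Polynomial.map_ofNat, map_ofNat]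

lemma quinticZ_map {R S : Type*} [CommRing R] [CommRing S] (φ : R →+* S) (A Δ M : R) :
    (quinticZ A Δ M).map φ = quinticZ (φ A) (φ Δ) (φ M) := by
  simp [quinticZ, map_ofNat]

section SymmetricGaloisGroup

variable {K L : Type*} [Field K] [Field L] [Algebra K L]
  (e : (L ≃ₐ[K] L) ≃* Equiv.Perm (Fin 5))

/-- An equivariant family is constant or injective, because `S₅` is doubly transitive. -/
lemma injective_of_equivariant {u : Fin 5 → L} (hu : ∀ g i, g (u i) = u (e g i))
    {a b : Fin 5} (hab : u a ≠ u b) : Function.Injective u := by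
  intro i j hij
  by_contra hne
  apply hab
  have hab' : a ≠ b := fun h ↦ hab (by rw [h])
  obtain ⟨π, hi, hj⟩ : ∃ π : Equiv.Perm (Fin 5), π i = a ∧ π j = b := by
    refine ⟨Equiv.swap b (Equiv.swap i a j) * Equiv.swap i a, ?_, ?_⟩
    · have : a ≠ Equiv.swap i a j := fun h ↦ hne (by
        rw [← Equiv.swap_apply_left i a] at h
        simpa using congrArg (Equiv.swap i a) h)
      simp [Equiv.swap_apply_of_ne_of_ne hab' this]
    · simp
  have := congrArg (e.symm π) hij
  rwa [hu, hu, e.apply_symm_apply, hi, hj] at this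

/-- An element fixed by the stabilizer of `0` gives rise to an equivariant family of conjugates. -/
lemma conj_equivariant {β : L} (hβ : ∀ g, e g 0 = 0 → g β = β) (g : L ≃ₐ[K] L) (i : Fin 5) :
    g (e.symm (Equiv.swap 0 i) β) = e.symm (Equiv.swap 0 (e g i)) β := by
  have := hβ ((e.symm (Equiv.swap 0 (e g i)))⁻¹ * g * e.symm (Equiv.swap 0 i)) (by simp)
  rw [AlgEquiv.mul_apply, AlgEquiv.mul_apply] at this
  have h2 := congrArg (e.symm (Equiv.swap 0 (e g i))) this
  rwa [← AlgEquiv.mul_apply, mul_inv_cancel, AlgEquiv.one_apply] at h2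

/-- Finite fields have cyclic Galois groups. -/
lemma infinite_of_gal_perm (e : (L ≃ₐ[K] L) ≃* Equiv.Perm (Fin 5)) [FiniteDimensional K L] :
    Infinite K := by
  by_contra h
  rw [not_infinite_iff_finite] at h
  have : Finite L := Module.finite_of_finite K
  obtain ⟨g, hg⟩ := IsCyclic.exists_generator (α := (L ≃ₐ[K] L))
  have hc : ∀ a b : L ≃ₐ[K] L, a * b = b * a := fun a b ↦ by
    obtain ⟨m, rfl⟩ := hg a
    obtain ⟨n, rfl⟩ := hg b
    exact (Commute.refl g).zpow_zpow m n
  have := congrArg e (hc (e.symm (Equiv.swap 0 1)) (e.symm (Equiv.swap 0 2)))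
  simp only [map_mul, e.apply_symm_apply] at this
  exact absurd this (by decide)

variable [FiniteDimensional K L] [IsGalois K L]

lemma exists_nonconstant_fixed :
    ∃ β : L, (∀ g, e g 0 = 0 → g β = β) ∧ ∃ g : L ≃ₐ[K] L, g β ≠ β := by
  by_contra! h
  set H : Subgroup (L ≃ₐ[K] L) :=
    (MulAction.stabilizer (Equiv.Perm (Fin 5)) (0 : Fin 5)).comap e.toMonoidHom with hH
  have hm (g) : g ∈ H ↔ e g 0 = 0 := Iff.rfl
  have h1 : IntermediateField.fixedField H = ⊥ := by
    rw [eq_bot_iff]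
    intro β hβ
    rw [IsGalois.mem_bot_iff_fixed]
    exact h β fun g hg ↦ hβ ⟨g, (hm g).2 hg⟩
  have h2 := IntermediateField.fixingSubgroup_fixedField H
  rw [h1, IntermediateField.fixingSubgroup_bot] at h2
  have h3 : e.symm (Equiv.swap 0 1) ∈ H := h2 ▸ Subgroup.mem_top _
  rw [hm, e.apply_symm_apply] at h3
  exact absurd h3 (by decide)

/-- Every extension with group `S₅` contains an equivariant family `y` with `genericity y ≠ 0`,
provided that `2`, `3`, `5` are nonzero. The family is a Tschirnhaus transformation `y i = ∑ j, c
j * z i ^ j` of a given injective equivariant family `z`, with coefficients `c j` in the infinite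
field `K`. -/
lemma exists_generic_family (h2 : (2 : L) ≠ 0) (h3 : (3 : L) ≠ 0) (h5 : (5 : L) ≠ 0) :
    ∃ y : Fin 5 → L, (∀ g i, g (y i) = y (e g i)) ∧ BinaryQuintic.genericity y ≠ 0 := by
  obtain ⟨β, hβ, g₀, hg₀⟩ := exists_nonconstant_fixed e
  set z : Fin 5 → L := fun i ↦ e.symm (Equiv.swap 0 i) β with hz
  have hzg : ∀ g i, g (z i) = z (e g i) := conj_equivariant e hβ
  have hz0 : z 0 = β := by simp [hz, Equiv.swap_self, ← Equiv.Perm.one_def]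
  have hzinj : Function.Injective z := by
    refine injective_of_equivariant e hzg (a := e g₀ 0) (b := 0) ?_
    rwa [← hzg, hz0]
  have hdet : IsUnit (Matrix.vandermonde z).det :=
    (Matrix.det_vandermonde_ne_zero_iff.2 hzinj).isUnit
  set w : Fin 5 → L := ![0, 1, 1, -1, -1] with hw
  have hinf := infinite_of_gal_perm e
  set T : MvPolynomial (Fin 5) L := BinaryQuintic.genericity
    (fun i ↦ ∑ j : Fin 5, MvPolynomial.C (z i ^ (j : ℕ)) * MvPolynomial.X j) with hT
  have hev (c : Fin 5 → L) : MvPolynomial.eval c T =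
      BinaryQuintic.genericity (fun i ↦ ∑ j : Fin 5, z i ^ (j : ℕ) * c j) := by
    rw [hT, ← BinaryQuintic.genericity_map]
    simp
  -- By the invertibility of the Vandermonde matrix, `T` takes the value of `genericity` at `w`.
  have hT0 : T ≠ 0 := by
    intro h0
    have h := hev ((Matrix.vandermonde z)⁻¹.mulVec w)
    have hv : (fun i ↦ ∑ j : Fin 5, z i ^ (j : ℕ) * ((Matrix.vandermonde z)⁻¹.mulVec w) j) = w := by
      have : (Matrix.vandermonde z).mulVec ((Matrix.vandermonde z)⁻¹.mulVec w) = w := by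
        rw [Matrix.mulVec_mulVec, Matrix.mul_nonsing_inv _ hdet, Matrix.one_mulVec]
      exact this
    rw [hv, h0, map_zero, hw, BinaryQuintic.genericity_witness] at h
    exact neg_ne_zero.2 (mul_ne_zero (mul_ne_zero (pow_ne_zero _ h2) (pow_ne_zero _ h3))
      (pow_ne_zero _ h5)) h.symm
  obtain ⟨c, hc⟩ : ∃ c : Fin 5 → K, MvPolynomial.eval (fun j ↦ algebraMap K L (c j)) T ≠ 0 := by
    by_contra! hall
    apply hT0
    refine MvPolynomial.funext_set (fun _ ↦ Set.range (algebraMap K L))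
      (fun _ ↦ Set.infinite_range_of_injective (algebraMap K L).injective) fun x hx ↦ ?_
    choose c hc using fun i ↦ hx i trivial
    rw [map_zero, ← hall c]
    congr 2
    exact (funext hc).symm
  refine ⟨fun i ↦ ∑ j : Fin 5, z i ^ (j : ℕ) * algebraMap K L (c j), fun g i ↦ ?_, ?_⟩
  · simp [map_sum, hzg]
  · rwa [hev] at hc

/-- Every extension with group `S₅` in characteristic not `2`, `3`, `5` is obtained from
`quinticU δ q` for suitable parameters, with roots on which the Galois group acts as on `Fin 5`. -/
theorem exists_quinticU_roots (h2 : (2 : L) ≠ 0) (h3 : (3 : L) ≠ 0) (h5 : (5 : L) ≠ 0) :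
    ∃ (δ q : K) (u : Fin 5 → L), q ≠ 0 ∧ Function.Injective u ∧
      (∀ i, aeval (u i) (quinticU δ q) = 0) ∧ ∀ g i, g (u i) = u (e g i) := by
  obtain ⟨y, hy, hgen⟩ := exists_generic_family e h2 h3 h5
  rw [BinaryQuintic.genericity] at hgen
  simp only [ne_eq, mul_eq_zero, not_or] at hgen
  obtain ⟨⟨⟨hA, hM⟩, hc4⟩, hne⟩ := hgen
  set F := BinaryQuintic.ofRoots y with hF
  have hFg (g : L ≃ₐ[K] L) : F.map (g : L →+* L) = F := by
    rw [hF, BinaryQuintic.ofRoots_map]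
    refine Eq.trans ?_ (BinaryQuintic.ofRoots_perm (e g) y)
    congr 1
    funext i
    exact hy g i
  obtain ⟨a, ha⟩ : F.invA ∈ Set.range (algebraMap K L) :=
    (IsGalois.mem_range_algebraMap_iff_fixed _).2 fun g ↦ by
      conv_rhs => rw [← hFg g, BinaryQuintic.invA_map]
      rfl
  obtain ⟨d, hd⟩ : F.invD ∈ Set.range (algebraMap K L) :=
    (IsGalois.mem_range_algebraMap_iff_fixed _).2 fun g ↦ by
      conv_rhs => rw [← hFg g, BinaryQuintic.invD_map]
      rfl
  obtain ⟨m, hm⟩ : F.invM ∈ Set.range (algebraMap K L) :=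
    (IsGalois.mem_range_algebraMap_iff_fixed _).2 fun g ↦ by
      conv_rhs => rw [← hFg g, BinaryQuintic.invM_map]
      rfl
  set u : Fin 5 → L := fun i ↦ (F.shift (y i)).resNum / (F.shift (y i)).resDen ^ 2 with hu
  have hsg (g : L ≃ₐ[K] L) (i : Fin 5) :
      (F.shift (y i)).map (g : L →+* L) = F.shift (y (e g i)) := by
    rw [BinaryQuintic.map_shift, hFg, ← hy]
    rfl
  have hug : ∀ (g : L ≃ₐ[K] L) i, g (u i) = u (e g i) := by
    intro g i
    simp only [hu]
    rw [← hsg, BinaryQuintic.resNum_map, BinaryQuintic.resDen_map, map_div₀, map_pow]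
    rfl
  have key (i : Fin 5) : (F.shift (y i)).resDen ≠ 0 ∧
      (quinticU (F.invD / (5 * F.invA ^ 2)) (25 * F.invA ^ 3 / (8192 * F.invM))).eval
        (u i) = 0 := by
    have hc4i : (F.shift (y i)).c4 ≠ 0 := by
      have h := hsg (e.symm (Equiv.swap 0 i)) 0
      rw [e.apply_symm_apply, Equiv.swap_apply_left] at h
      rw [← h]
      exact (map_ne_zero (e.symm (Equiv.swap 0 i) : L →+* L)).2 hc4
    have eA : (F.shift (y i)).invA = F.invA := BinaryQuintic.invA_shift _ _
    have eD : (F.shift (y i)).invD = F.invD := by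
      rw [BinaryQuintic.invD, BinaryQuintic.invA_shift, BinaryQuintic.invB_shift]; rfl
    have eM : (F.shift (y i)).invM = F.invM := by
      rw [BinaryQuintic.invM, BinaryQuintic.invA_shift, BinaryQuintic.invB_shift,
        BinaryQuintic.invC_shift]; rfl
    have := BinaryQuintic.resDen_ne_zero_and_root h2 h5 (F.shift (y i))
      (BinaryQuintic.c5_shift_ofRoots y i) hc4i (eA ▸ hA) (eM ▸ hM)
    rwa [eA, eD, eM] at this
  have h2K : (2 : K) ≠ 0 := fun h ↦ h2 (by simpa [map_ofNat] using congrArg (algebraMap K L) h)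
  have h5K : (5 : K) ≠ 0 := fun h ↦ h5 (by simpa [map_ofNat] using congrArg (algebraMap K L) h)
  refine ⟨d / (5 * a ^ 2), 25 * a ^ 3 / (8192 * m), u, ?_, ?_, fun i ↦ ?_, hug⟩
  · have h8 : (8192 : K) = 2 ^ 13 := by norm_num
    have h25 : (25 : K) = 5 ^ 2 := by norm_num
    have ha0 : a ≠ 0 := fun h ↦ hA (by rw [← ha, h, map_zero])
    have hm0 : m ≠ 0 := fun h ↦ hM (by rw [← hm, h, map_zero])
    rw [h8, h25]
    exact div_ne_zero (mul_ne_zero (pow_ne_zero _ h5K) (pow_ne_zero _ ha0))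
      (mul_ne_zero (pow_ne_zero _ h2K) hm0)
  · refine injective_of_equivariant e hug (a := 0) (b := 1) fun h ↦ hne ?_
    simp only [hu] at h
    rw [div_eq_div_iff (pow_ne_zero _ (key 0).1) (pow_ne_zero _ (key 1).1)] at h
    rw [h, sub_self]
  · have hmap : (quinticU (d / (5 * a ^ 2)) (25 * a ^ 3 / (8192 * m))).map (algebraMap K L) =
        quinticU (F.invD / (5 * F.invA ^ 2)) (25 * F.invA ^ 3 / (8192 * F.invM)) := by
      rw [← ha, ← hd, ← hm]
      simp [quinticU_map, map_ofNat]
    rw [aeval_def, ← eval_map, hmap]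
    exact (key i).2

end SymmetricGaloisGroup

/-! ### Ring homomorphisms on integral extensions -/

section Extension

/-- A ring homomorphism to an algebraically closed field extends to integral extensions. -/
lemma exists_ringHom_extension {A B Ω : Type*} [CommRing A] [CommRing B] [IsDomain B]
    [Algebra A B] [Algebra.IsIntegral A B] (hinj : Function.Injective (algebraMap A B))
    [Field Ω] [IsAlgClosed Ω] (φ : A →+* Ω) :
    ∃ ψ : B →+* Ω, ψ.comp (algebraMap A B) = φ := by
  have hprime : (RingHom.ker φ).IsPrime := RingHom.ker_isPrime φ
  obtain ⟨Q, hQ, hQp⟩ := Ideal.exists_ideal_over_prime_of_isIntegral_of_isDomain (S := B)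
    (RingHom.ker φ) (by rw [(RingHom.injective_iff_ker_eq_bot _).1 hinj]; exact bot_le)
  have : Q.LiesOver (RingHom.ker φ) := ⟨hQp.symm⟩
  let : Algebra (A ⧸ RingHom.ker φ) Ω := (RingHom.kerLift φ).toAlgebra
  have : Module.IsTorsionFree (A ⧸ RingHom.ker φ) Ω :=
    Module.isTorsionFree_iff_algebraMap_injective.2 (RingHom.kerLift_injective φ)
  have : Module.IsTorsionFree (A ⧸ RingHom.ker φ) (B ⧸ Q) :=
    Module.isTorsionFree_iff_faithfulSMul.2 inferInstance
  let ψ : (B ⧸ Q) →ₐ[A ⧸ RingHom.ker φ] Ω := IsAlgClosed.lift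
  refine ⟨(ψ : (B ⧸ Q) →+* Ω).comp (Ideal.Quotient.mk Q), ?_⟩
  ext a
  exact ψ.commutes (Ideal.Quotient.mk _ a)

open MulSemiringAction in
/-- Two ring homomorphisms to a domain that agree on the invariants of a finite group `G` agree, on
each element, up to `G`: both map the roots of the orbit polynomial to its roots. -/
lemma exists_smul_eq_of_comp_eq {A B Ω G : Type*} [CommRing A] [CommRing B] [Algebra A B]
    [Group G] [Finite G] [MulSemiringAction G B] [Algebra.IsInvariant A B G]
    [CommRing Ω] [IsDomain Ω] {ψ ψ' : B →+* Ω}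
    (h : ψ.comp (algebraMap A B) = ψ'.comp (algebraMap A B)) (b : B) :
    ∃ σ : G, ψ' b = ψ (σ • b) := by
  cases nonempty_fintype G
  obtain ⟨M, hM⟩ := (mem_lifts _).1 (Algebra.IsInvariant.charpoly_mem_lifts A B G b)
  have h1 : eval (ψ' b) ((charpoly G b).map ψ') = 0 := by
    rw [eval_map, eval₂_hom, eval_charpoly, map_zero]
  rw [← hM, Polynomial.map_map, ← h, ← Polynomial.map_map, hM, charpoly_eq,
    Polynomial.map_prod, eval_prod, Finset.prod_eq_zero_iff] at h1
  obtain ⟨σ, -, hσ⟩ := h1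
  exact ⟨σ, by simpa [sub_eq_zero] using hσ⟩

/-- The group element can be chosen uniformly for a finite family `s`: apply the statement for one
element to the polynomial `∑ i, s i * X ^ i`. -/
lemma exists_smul_eq_of_comp_eq_family {A B Ω G : Type*} [CommRing A] [CommRing B] [Algebra A B]
    [Group G] [Finite G] [MulSemiringAction G B] [Algebra.IsInvariant A B G]
    [CommRing Ω] [IsDomain Ω] {ψ ψ' : B →+* Ω}
    (h : ψ.comp (algebraMap A B) = ψ'.comp (algebraMap A B)) {n : ℕ} (s : Fin n → B) :
    ∃ σ : G, ∀ i, ψ' (s i) = ψ (σ • s i) := by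
  let : Algebra A[X] B[X] := Polynomial.algebra A B
  have hinv : Algebra.IsInvariant A[X] B[X] G := by
    refine ⟨fun f hf ↦ ?_⟩
    have hc (k : ℕ) : ∃ a, algebraMap A B a = f.coeff k :=
      Algebra.IsInvariant.isInvariant (G := G) (f.coeff k) fun g ↦ by
        conv_rhs => rw [← hf g]
        exact (Polynomial.coeff_smul g f k).symm
    obtain ⟨p, hp⟩ := (mem_lifts f).1 ((lifts_iff_coeff_lifts f).2 hc)
    exact ⟨p, hp⟩
  have hcomp : (mapRingHom ψ).comp (algebraMap A[X] B[X]) =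
      (mapRingHom ψ').comp (algebraMap A[X] B[X]) := by
    have h0 : algebraMap A[X] B[X] = mapRingHom (algebraMap A B) := rfl
    rw [h0, mapRingHom_comp, mapRingHom_comp, h]
  obtain ⟨σ, hσ⟩ := exists_smul_eq_of_comp_eq (G := G) hcomp (∑ i, C (s i) * X ^ (i : ℕ))
  refine ⟨σ, fun i ↦ ?_⟩
  have := congrArg (fun p ↦ coeff p (i : ℕ)) hσ
  simpa [coeff_X_pow, Polynomial.coeff_smul, finsetSum_coeff, Fin.val_inj, Finset.smul_sum]
    using this

end Extension

/-! ### Galois groups under specialization -/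

section RootFamily

variable {F E : Type*} [Field F] [Field E] [Algebra F E]

/-- A splitting field in which all permutations of the roots are realized by automorphisms has the
full symmetric group as Galois group. -/
lemma galoisGroup_of_perm {P : F[X]} [hE : P.IsSplittingField F E] {n : ℕ}
    {r : Fin n → E} (hr : Function.Injective r) (hroot : ∀ x : E, aeval x P = 0 ↔ ∃ i, r i = x)
    (hσ : ∀ π : Equiv.Perm (Fin n), ∃ σ : E ≃ₐ[F] E, ∀ i, σ (r i) = r (π i)) :
    Nonempty ((E ≃ₐ[F] E) ≃* Equiv.Perm (Fin n)) := by
  have hext {σ τ : E ≃ₐ[F] E} (h : ∀ i, σ (r i) = τ (r i)) : σ = τ := by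
    have : (σ : E →ₐ[F] E) = τ := by
      refine AlgHom.ext_of_adjoin_eq_top hE.adjoin_rootSet' fun x hx ↦ ?_
      obtain ⟨i, rfl⟩ := (hroot x).1 (mem_rootSet.1 hx).2
      exact h i
    exact AlgEquiv.ext fun x ↦ DFunLike.congr_fun this x
  choose f hf using hσ
  refine ⟨(MulEquiv.ofBijective (MonoidHom.mk' f fun π π' ↦ hext fun i ↦ ?_) ⟨?_, ?_⟩).symm⟩
  · rw [hf, AlgEquiv.mul_apply, hf, hf, Equiv.Perm.mul_apply]
  · intro π π' h
    ext i
    have := (hf π i).symm.trans ((DFunLike.congr_fun h (r i)).trans (hf π' i))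
    exact congrArg Fin.val (hr this)
  · intro σ
    have hex (i) : ∃ j, r j = σ (r i) := by
      refine (hroot _).1 ?_
      rw [aeval_algHom_apply, (hroot _).2 ⟨i, rfl⟩, map_zero]
    choose t ht using hex
    have hinj : Function.Injective t := fun i j h ↦ hr (σ.injective (by rw [← ht, ← ht, h]))
    refine ⟨Equiv.ofBijective t (Finite.injective_iff_bijective.1 hinj), hext fun i ↦ ?_⟩
    exact (hf _ i).trans (ht i)

/-- A polynomial is irreducible if all permutations of its roots are realized. -/
lemma irreducible_of_perm {P : F[X]} (hP : P ≠ 0) {n : ℕ} [NeZero n] (hn : P.natDegree = n)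
    {r : Fin n → E} (hr : Function.Injective r) (hroot : ∀ i, aeval (r i) P = 0)
    (hσ : ∀ π : Equiv.Perm (Fin n), ∃ σ : E ≃ₐ[F] E, ∀ i, σ (r i) = r (π i)) :
    Irreducible P := by
  have hint : IsIntegral F (r 0) := (isAlgebraic_iff_isIntegral).1 ⟨P, hP, hroot 0⟩
  have hdvd : minpoly F (r 0) ∣ P := minpoly.dvd F _ (hroot 0)
  have hmr (i) : aeval (r i) (minpoly F (r 0)) = 0 := by
    obtain ⟨σ, h⟩ := hσ (Equiv.swap 0 i)
    have h0 := h 0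
    rw [Equiv.swap_apply_left] at h0
    rw [← h0, aeval_algHom_apply, minpoly.aeval, map_zero]
  have hcard : n ≤ (minpoly F (r 0)).natDegree := by
    classical
    have hsub : Finset.univ.image r ⊆ ((minpoly F (r 0)).aroots E).toFinset := by
      intro x hx
      obtain ⟨i, -, rfl⟩ := Finset.mem_image.1 hx
      rw [Multiset.mem_toFinset, mem_aroots]
      exact ⟨minpoly.ne_zero hint, hmr i⟩
    calc n = (Finset.univ.image r).card := by
            rw [Finset.card_image_of_injective _ hr, Finset.card_fin]
      _ ≤ _ := Finset.card_le_card hsub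
      _ ≤ _ := Multiset.toFinset_card_le _
      _ ≤ _ := card_roots' _
      _ = _ := natDegree_map _
  exact (associated_of_dvd_of_natDegree_le hdvd hP (hn.trans_le hcard)).irreducible
    (minpoly.irreducible hint)

lemma roots_eq_map_of_natDegree_eq {P : E[X]} (hP : P ≠ 0) {n : ℕ} (hn : P.natDegree = n)
    {r : Fin n → E} (hr : Function.Injective r) (hroot : ∀ i, P.eval (r i) = 0) :
    P.roots = Finset.univ.val.map r := by
  classical
  have hle : Finset.univ.val.map r ≤ P.roots := by
    rw [Multiset.le_iff_subset (Multiset.Nodup.map hr Finset.univ.nodup)]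
    intro x hx
    obtain ⟨i, -, rfl⟩ := Multiset.mem_map.1 hx
    exact (mem_roots hP).2 (hroot i)
  exact (Multiset.eq_of_le_of_card_le hle (by
    simpa [hn] using card_roots' P)).symm

lemma isSplittingField_of_family [FiniteDimensional F E] [IsGalois F E] {P : F[X]} (hP : P ≠ 0)
    {n : ℕ} (hn : P.natDegree = n) {r : Fin n → E} (hr : Function.Injective r)
    (hroot : ∀ i, aeval (r i) P = 0)
    (hfaithful : ∀ σ : E ≃ₐ[F] E, (∀ i, σ (r i) = r i) → σ = 1) :
    P.IsSplittingField F E := by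
  rw [isSplittingField_iff_intermediateField]
  have hP' : P.map (algebraMap F E) ≠ 0 :=
    (Polynomial.map_ne_zero_iff (algebraMap F E).injective).2 hP
  refine ⟨?_, ?_⟩
  · rw [splits_iff_card_roots, roots_eq_map_of_natDegree_eq hP' ((natDegree_map _).trans hn) hr
      (fun i ↦ by rw [eval_map_algebraMap, hroot]), natDegree_map, hn]
    simp
  · have hbot : (IntermediateField.adjoin F (P.rootSet E)).fixingSubgroup = ⊥ := by
      rw [eq_bot_iff]
      intro σ hσ
      refine hfaithful σ fun i ↦ ?_
      exact hσ ⟨r i, IntermediateField.subset_adjoin F _ (mem_rootSet.2 ⟨hP, hroot i⟩)⟩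
    rw [← IsGalois.fixedField_fixingSubgroup (IntermediateField.adjoin F (P.rootSet E)), hbot,
      IntermediateField.fixedField_bot]

end RootFamily

/-- Specialization cannot enlarge Galois groups. If `N` over the integrally closed domain `A`
specializes along `φ : A →+* K` to a polynomial of the same degree `n` with distinct roots `z`, all
of whose permutations are realized by automorphisms over `K`, then `N` is separable and irreducible
over the fraction field of `A` and has the symmetric group as Galois group. -/
theorem gal_of_specialization {A F K L : Type*} [CommRing A] [IsDomain A] [IsIntegrallyClosed A]
    [Field F] [Algebra A F] [IsFractionRing A F] [Field K] [Field L] [Algebra K L]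
    [Algebra.IsAlgebraic K L] (φ : A →+* K) {N : A[X]} {n : ℕ} [NeZero n] (hn : N.natDegree = n)
    (hlc : φ N.leadingCoeff ≠ 0) {z : Fin n → L} (hz : Function.Injective z)
    (hroot : ∀ i, aeval (z i) (N.map φ) = 0)
    (hperm : ∀ π : Equiv.Perm (Fin n), ∃ g : L ≃ₐ[K] L, ∀ i, g (z i) = z (π i)) :
    (N.map (algebraMap A F)).Separable ∧ Irreducible (N.map (algebraMap A F)) ∧
      Nonempty ((N.map (algebraMap A F)).Gal ≃* Equiv.Perm (Fin n)) := by
  classical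
  set P := N.map (algebraMap A F)
  have hAF : Function.Injective (algebraMap A F) := IsFractionRing.injective A F
  have hN0 : N ≠ 0 := fun h ↦ hlc (by rw [h, leadingCoeff_zero, map_zero])
  have hP0 : P ≠ 0 := (Polynomial.map_ne_zero_iff hAF).2 hN0
  have hPn : P.natDegree = n := (natDegree_map_eq_of_injective hAF N).trans hn
  let E := P.SplittingField
  let Ω := AlgebraicClosure L
  let B := integralClosure A E
  have hAE : Function.Injective (algebraMap A E) := by
    rw [IsScalarTower.algebraMap_eq A F E]
    exact (algebraMap F E).injective.comp hAF
  have hAB : Function.Injective (algebraMap A B) := by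
    intro a b h
    exact hAE (congrArg (algebraMap B E) h)
  obtain ⟨ψ, hψ⟩ := exists_ringHom_extension (B := B) hAB
    (((algebraMap L Ω).comp (algebraMap K L)).comp φ)
  have hψA (a : A) : ψ (algebraMap A B a) = algebraMap L Ω (algebraMap K L (φ a)) :=
    DFunLike.congr_fun hψ a
  set l := N.leadingCoeff
  -- The roots of `N` need not be integral over `A`, but their multiples by `l` are.
  have hs (x : E) (hx : x ∈ (N.map (algebraMap A E)).roots) : IsIntegral A (l • x) := by
    refine isIntegral_leadingCoeff_smul N x ?_
    rw [← eval_map_algebraMap]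
    exact (mem_roots'.1 hx).2
  let s : E → B := fun x ↦ if h : IsIntegral A (l • x) then ⟨l • x, h⟩ else 0
  have hsv (x : E) (hx : x ∈ (N.map (algebraMap A E)).roots) :
      (s x : E) = algebraMap A E l * x := by
    have h : s x = ⟨l • x, hs x hx⟩ := dif_pos (hs x hx)
    exact (congrArg Subtype.val h).trans (Algebra.smul_def l x)
  have hNE : N.map (algebraMap A E) = P.map (algebraMap F E) := by
    have h := Polynomial.map_map (algebraMap A F) (algebraMap F E) N
    rw [← IsScalarTower.algebraMap_eq A F E] at h
    exact h.symm
  have hsplit : (N.map (algebraMap A E)).Splits := by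
    rw [hNE]; exact SplittingField.splits P
  have hfac : C (algebraMap A B l) ^ n * N.map (algebraMap A B) = C (algebraMap A B l) *
      ((N.map (algebraMap A E)).roots.map
        fun x ↦ C (algebraMap A B l) * X - C (s x)).prod := by
    apply Polynomial.map_injective (algebraMap B E) Subtype.val_injective
    have h1 : (N.map (algebraMap A B)).map (algebraMap B E) = N.map (algebraMap A E) := by
      rw [Polynomial.map_map]; rfl
    have h2 : algebraMap B E (algebraMap A B l) = algebraMap A E l := rfl
    have h3 : (N.map (algebraMap A E)).leadingCoeff = algebraMap A E l :=
      leadingCoeff_map_of_injective hAE N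
    have hcard : (N.map (algebraMap A E)).roots.card = n := by
      rw [splits_iff_card_roots.1 hsplit, natDegree_map_eq_of_injective hAE, hn]
    have h4 : ((N.map (algebraMap A E)).roots.map
        fun x ↦ (C (algebraMap A B l) * X - C (s x)).map (algebraMap B E)) =
        (N.map (algebraMap A E)).roots.map fun x ↦ C (algebraMap A E l) * (X - C x) := by
      refine Multiset.map_congr rfl fun x hx ↦ ?_
      rw [Polynomial.map_sub, Polynomial.map_mul, map_C, map_C, map_X, h2, mul_sub, ← C_mul,
        ← hsv x hx]
      rfl
    rw [Polynomial.map_mul, Polynomial.map_mul, Polynomial.map_pow, map_C, h1, h2,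
      Polynomial.map_multiset_prod, Multiset.map_map, Function.comp_def, h4,
      Multiset.prod_map_mul, Multiset.map_const', Multiset.prod_replicate, hcard]
    conv_lhs => rw [← C_leadingCoeff_mul_prod_multiset_X_sub_C
      (splits_iff_card_roots.1 hsplit), h3]
    ring
  have hl0 : algebraMap L Ω (algebraMap K L (φ l)) ≠ 0 :=
    (_root_.map_ne_zero _).2 ((_root_.map_ne_zero _).2 hlc)
  -- So `ψ` maps the multiples of the roots of `N` by `l` onto those of the `z i` by `φ l`.
  have hex (i : Fin n) : ∃ x ∈ (N.map (algebraMap A E)).roots,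
      ψ (s x) = algebraMap L Ω (algebraMap K L (φ l) * z i) := by
    have h := congrArg (fun f ↦ eval₂ ψ (algebraMap L Ω (z i)) f) hfac
    simp only [eval₂_mul, eval₂_pow, eval₂_C, hψA] at h
    have h0 : eval₂ ψ (algebraMap L Ω (z i)) (N.map (algebraMap A B)) = 0 := by
      rw [eval₂_map, hψ, RingHom.comp_assoc, ← hom_eval₂, ← eval₂_map, ← aeval_def, hroot,
        map_zero]
    rw [h0, mul_zero, eq_comm, mul_eq_zero, or_iff_right hl0, ← coe_eval₂RingHom,
      map_multiset_prod, Multiset.prod_eq_zero_iff, Multiset.map_map] at h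
    obtain ⟨x, hx, hx0⟩ := Multiset.mem_map.1 h
    refine ⟨x, hx, ?_⟩
    simp only [Function.comp_apply, coe_eval₂RingHom, eval₂_sub, eval₂_mul, eval₂_C, eval₂_X,
      hψA, sub_eq_zero] at hx0
    rw [map_mul, hx0]
  choose r hr hrψ using hex
  have hcancel {i j : Fin n} (h : algebraMap L Ω (algebraMap K L (φ l) * z i) =
      algebraMap L Ω (algebraMap K L (φ l) * z j)) : i = j := by
    rw [map_mul, map_mul] at h
    exact hz ((algebraMap L Ω).injective (mul_left_cancel₀ hl0 h))
  have hrinj : Function.Injective r := fun i j h ↦ hcancel (by rw [← hrψ, ← hrψ, h])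
  have hNE0 : N.map (algebraMap A E) ≠ 0 := (Polynomial.map_ne_zero_iff hAE).2 hN0
  have hroots : (N.map (algebraMap A E)).roots = Finset.univ.val.map r :=
    roots_eq_map_of_natDegree_eq hNE0 ((natDegree_map_eq_of_injective hAE N).trans hn) hrinj
      fun i ↦ (mem_roots'.1 (hr i)).2
  have hsep : P.Separable := by
    rw [← separable_map (algebraMap F E), ← hNE, ← nodup_roots_iff_of_splits hNE0 hsplit, hroots]
    exact Multiset.Nodup.map hrinj Finset.univ.nodup
  have hiff (x : E) : aeval x P = 0 ↔ ∃ i, r i = x := by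
    rw [← eval_map_algebraMap, ← hNE, ← IsRoot.def, ← mem_roots hNE0, hroots]
    simp
  have hgal : IsGalois F E := IsGalois.of_separable_splitting_field hsep
  have hfrac : IsFractionRing B E := integralClosure.isFractionRing_of_finite_extension F E
  let := IsIntegralClosure.MulSemiringAction A F E B
  have hinv : Algebra.IsInvariant A B (E ≃ₐ[F] E) := Algebra.isInvariant_of_isGalois A F E B
  -- A lift of an automorphism over `K`, composed with `ψ`, differs from `ψ` by some `σ`.
  have hreal (π : Equiv.Perm (Fin n)) : ∃ σ : E ≃ₐ[F] E, ∀ i, σ (r i) = r (π i) := by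
    obtain ⟨g, hg⟩ := hperm π
    let γ : Ω →+* Ω := ((g.liftNormal Ω : Ω ≃ₐ[K] Ω) : Ω →+* Ω)
    have hγ (x : L) : γ (algebraMap L Ω x) = algebraMap L Ω (g x) := g.liftNormal_commutes Ω x
    obtain ⟨σ, hσ⟩ := exists_smul_eq_of_comp_eq_family (G := E ≃ₐ[F] E) (ψ := ψ)
      (ψ' := γ.comp ψ) (by
        ext a
        rw [RingHom.comp_apply, RingHom.comp_apply, RingHom.comp_apply, hψA, hγ, g.commutes])
      (fun i ↦ s (r i))
    refine ⟨σ, fun i ↦ ?_⟩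
    obtain ⟨j, hj⟩ := (hiff (σ (r i))).1 (by
      rw [aeval_algHom_apply, (hiff _).2 ⟨i, rfl⟩, map_zero])
    have h1 : σ • s (r i) = s (r j) := by
      apply Subtype.val_injective
      rw [hsv _ (hr j), hj]
      refine (algebraMap_galRestrict_apply A (K := F) (L := E) (B := B) σ (s (r i))).trans ?_
      change σ (s (r i) : E) = _
      rw [hsv _ (hr i), map_mul, IsScalarTower.algebraMap_apply A F E, σ.commutes]
    have h2 := hσ i
    rw [h1, hrψ, RingHom.comp_apply, hrψ] at h2
    have h3 : algebraMap L Ω (algebraMap K L (φ l) * z (π i)) =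
        algebraMap L Ω (algebraMap K L (φ l) * z j) := by
      rw [← h2, hγ, map_mul g, g.commutes, hg]
    rw [← hj, hcancel h3]
  exact ⟨hsep, irreducible_of_perm hP0 hPn hrinj (fun i ↦ (hiff _).2 ⟨i, rfl⟩) hreal,
    galoisGroup_of_perm hrinj hiff hreal⟩

/-! ### From parametrization to genericity -/

section GenericPolynomial

/-- Over every field `k` there is an extension with group `Sₙ`: the field of rational functions in
`n` variables over the fixed field of the permutations of the variables. -/
theorem exists_isGalois_perm (k : Type u) [Field k] (n : ℕ) :
    ∃ (K L : Type u) (_ : Field K) (_ : Field L) (_ : Algebra k K) (_ : Algebra K L)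
      (_ : FiniteDimensional K L) (_ : IsGalois K L),
      Nonempty ((L ≃ₐ[K] L) ≃* Equiv.Perm (Fin n)) := by
  let B := MvPolynomial (Fin n) k
  let L := FractionRing B
  let ρ : Equiv.Perm (Fin n) →* (B ≃ₐ[k] B) :=
    { toFun := fun π ↦ MvPolynomial.renameEquiv k π
      map_one' := by ext i; simp
      map_mul' := fun π π' ↦ by
        ext i
        simp [AlgEquiv.mul_apply] }
  have hρ : Function.Injective ρ := by
    intro π π' h
    ext i
    have h1 := DFunLike.congr_fun h (MvPolynomial.X i)
    change MvPolynomial.rename π (MvPolynomial.X i) =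
      MvPolynomial.rename π' (MvPolynomial.X i) at h1
    rw [MvPolynomial.rename_X, MvPolynomial.rename_X] at h1
    exact congrArg Fin.val (MvPolynomial.X_injective h1)
  let θ := (IsFractionRing.fieldEquivOfAlgEquivHom (A := k) (B := B) k L).comp ρ
  have hθ : Function.Injective θ :=
    (IsFractionRing.fieldEquivOfAlgEquivHom_injective k B k L).comp hρ
  let H := θ.range
  have hH : Finite H := Set.finite_range θ
  have hk (a : k) : algebraMap k L a ∈ FixedPoints.subfield H L :=
    fun g ↦ (g : L ≃ₐ[k] L).commutes a
  let : Algebra k (FixedPoints.subfield H L) := ((algebraMap k L).codRestrict _ hk).toAlgebra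
  exact ⟨FixedPoints.subfield H L, L, inferInstance, inferInstance, inferInstance, inferInstance,
    inferInstance, inferInstance,
    ⟨(FixedPoints.toAlgAutMulEquiv H L).symm.trans (MonoidHom.ofInjective hθ).symm⟩⟩

/-- The specializations of `N` parametrize the extensions with group `Sₙ` over fields in which the
elements of `S` are nonzero: for some `τ`, the degree of `N` does not drop and the specialized
polynomial has distinct roots `z` on which the Galois group acts through the given isomorphism. -/
def ParametrizesPerm (S : Finset ℕ) {m : ℕ} (N : (MvPolynomial (Fin m) ℤ)[X]) (n : ℕ) : Prop :=
  ∀ (K : Type u) (L : Type v) [Field K] [Field L] [Algebra K L] [FiniteDimensional K L]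
    [IsGalois K L] (e : (L ≃ₐ[K] L) ≃* Equiv.Perm (Fin n)), (∀ p ∈ S, (p : K) ≠ 0) →
    ∃ (τ : Fin m → K) (z : Fin n → L),
      MvPolynomial.eval₂Hom (Int.castRingHom K) τ N.leadingCoeff ≠ 0 ∧ Function.Injective z ∧
      (∀ i, aeval (z i) (N.map (MvPolynomial.eval₂Hom (Int.castRingHom K) τ)) = 0) ∧
      ∀ g i, g (z i) = z (e g i)

variable {m : ℕ} (N : (MvPolynomial (Fin m) ℤ)[X])

lemma eval₂Hom_comp_map_intCast {k K : Type*} [Field k] [Field K] (φ : k →+* K) (τ : Fin m → K) :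
    (MvPolynomial.eval₂Hom φ τ).comp (MvPolynomial.map (Int.castRingHom k)) =
      MvPolynomial.eval₂Hom (Int.castRingHom K) τ := by
  ext i <;> simp

lemma isSpecialization_map {k : Type u} {K : Type v} [Field k] [Field K] (φ : k →+* K)
    (τ : Fin m → K) :
    IsSpecialization φ (N.map (intParamHom k m)) τ
      (N.map (MvPolynomial.eval₂Hom (Int.castRingHom K) τ)) :=
  ⟨1, N.map (MvPolynomial.map (Int.castRingHom k)), by simp,
    by rw [Polynomial.map_map, map_one, C_1, one_mul]; rfl,
    by rw [Polynomial.map_map, map_one, C_1, one_mul, eval₂Hom_comp_map_intCast]⟩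

lemma isReductionMod_map (p : ℕ) [Fact p.Prime] :
    IsReductionMod p (N.map (intParamHom ℚ m)) (N.map (intParamHom (ZMod p) m)) :=
  ⟨1, N, by simp, by simp, by simp⟩

variable {N} {S : Finset ℕ} {n : ℕ}

lemma ParametrizesPerm.exists_isSplittingField (h : ParametrizesPerm.{u, v} S N n)
    (hn : N.natDegree = n)
    {K : Type u} {L : Type v} [Field K] [Field L] [Algebra K L] [FiniteDimensional K L]
    [IsGalois K L] (hS : ∀ p ∈ S, (p : K) ≠ 0) (hG : Nonempty ((L ≃ₐ[K] L) ≃* Equiv.Perm (Fin n))) :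
    ∃ τ : Fin m → K,
      (N.map (MvPolynomial.eval₂Hom (Int.castRingHom K) τ)).IsSplittingField K L := by
  obtain ⟨e⟩ := hG
  obtain ⟨τ, z, hlc, hz, hroot, hg⟩ := h K L e hS
  have hdeg := (natDegree_map_of_leadingCoeff_ne_zero _ hlc).trans hn
  refine ⟨τ, isSplittingField_of_family (fun h0 ↦ hlc ?_) hdeg hz hroot fun σ hσ ↦ ?_⟩
  · have := congrArg (fun f ↦ coeff f N.natDegree) h0
    simpa [coeff_map] using this
  · refine e.injective (Equiv.ext fun i ↦ hz ?_)
    rw [← hg, hσ, map_one, Equiv.Perm.one_apply]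

lemma ParametrizesPerm.separable_irreducible_gal [NeZero n] (h : ParametrizesPerm.{u, u} S N n)
    (hn : N.natDegree = n) (k : Type u) [Field k] (hS : ∀ p ∈ S, (p : k) ≠ 0) :
    (N.map (intParamHom k m)).Separable ∧ Irreducible (N.map (intParamHom k m)) ∧
      Nonempty ((N.map (intParamHom k m)).Gal ≃* Equiv.Perm (Fin n)) := by
  obtain ⟨K, L, _, _, _, _, _, _, ⟨e⟩⟩ := exists_isGalois_perm k n
  obtain ⟨τ, z, hlc, hz, hroot, hg⟩ := h K L e fun p hp h0 ↦ hS p hp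
    ((algebraMap k K).injective (by rw [map_natCast, h0, map_zero]))
  have hcomp := eval₂Hom_comp_map_intCast (algebraMap k K) τ
  rw [← hcomp, RingHom.comp_apply] at hlc
  have hlc0 : MvPolynomial.map (Int.castRingHom k) N.leadingCoeff ≠ 0 := fun h0 ↦
    hlc (by rw [h0, map_zero])
  have key := gal_of_specialization (F := ParamField k m)
    (MvPolynomial.eval₂Hom (algebraMap k K) τ)
    (N := N.map (MvPolynomial.map (Int.castRingHom k)))
    ((natDegree_map_of_leadingCoeff_ne_zero _ hlc0).trans hn)
    (by rwa [leadingCoeff_map_of_leadingCoeff_ne_zero _ hlc0]) hz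
    (fun i ↦ by rw [Polynomial.map_map, hcomp]; exact hroot i)
    fun π ↦ ⟨e.symm π, fun i ↦ by rw [hg, e.apply_symm_apply]⟩
  rw [Polynomial.map_map] at key
  exact key

lemma natCast_ne_zero_of_notMem (hS : ∀ l ∈ S, l.Prime) {p : ℕ} [Fact p.Prime] (hp : p ∉ S)
    {K : Type*} [Field K] [CharP K p] : ∀ l ∈ S, (l : K) ≠ 0 := fun l hl h0 ↦ by
  rw [CharP.cast_eq_zero_iff K p, Nat.prime_dvd_prime_iff_eq Fact.out (hS l hl)] at h0
  exact hp (h0 ▸ hl)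

/-- A parametrizing polynomial over `ℤ[t₁, …, tₘ]` is generic. Its own Galois groups, in
characteristic zero and modulo `p`, are found by specializing it to an extension with group `Sₙ`. -/
theorem ParametrizesPerm.isGenericOutside [NeZero n] (h : ParametrizesPerm.{u, v} S N n)
    (h0 : ParametrizesPerm.{0, 0} S N n) (hn : N.natDegree = n) (hS : ∀ p ∈ S, p.Prime) :
    IsGenericOutside.{u, v, 0} S (Equiv.Perm (Fin n)) (N.map (intParamHom ℚ m)) := by
  refine ⟨?_, ?_, ?_, ?_⟩
  · exact (h0.separable_irreducible_gal hn ℚ fun p hp ↦ by exact_mod_cast (hS p hp).ne_zero).2.2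
  · intro p _ hp
    refine ⟨_, isReductionMod_map N p, h0.separable_irreducible_gal hn (ZMod p)
      (natCast_ne_zero_of_notMem hS hp)⟩
  · intro K L _ _ _ _ _ _ hG
    obtain ⟨τ, hτ⟩ := h.exists_isSplittingField hn
      (fun p hp ↦ by exact_mod_cast (hS p hp).ne_zero) hG
    exact ⟨τ, _, isSpecialization_map N _ τ, hτ⟩
  · intro p _ hp K L _ _ _ _ _ _ hG
    obtain ⟨τ, hτ⟩ := h.exists_isSplittingField hn (natCast_ne_zero_of_notMem hS hp) hG
    exact ⟨_, τ, _, isReductionMod_map N p, isSpecialization_map N _ τ, hτ⟩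

end GenericPolynomial

/-! ### The two quintics -/

section Quintics

variable {R : Type*} [CommRing R]

lemma quinticU_monic_natDegree [Nontrivial R] (δ q : R) :
    (quinticU δ q).Monic ∧ (quinticU δ q).natDegree = 5 := by
  have h50 : (X ^ 2 * (X + 50) ^ 3 : R[X]) = X ^ 2 * (X + C 50) ^ 3 := rfl
  have hmon : (X ^ 2 * (X + 50) ^ 3 : R[X]).Monic := by
    rw [h50]; exact (monic_X_pow 2).mul ((monic_X_add_C 50).pow 3)
  have hdeg : (X ^ 2 * (X + 50) ^ 3 : R[X]).natDegree = 5 := by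
    rw [h50, (monic_X_pow 2).natDegree_mul ((monic_X_add_C 50).pow 3), natDegree_X_pow,
      (monic_X_add_C 50).natDegree_pow, natDegree_X_add_C]
  have hlow : (quinticU δ q - X ^ 2 * (X + 50) ^ 3).natDegree ≤ 4 := by
    rw [quinticU, add_sub_right_comm, sub_sub_cancel_left]
    compute_degree
  have hlt : (quinticU δ q - X ^ 2 * (X + 50) ^ 3).degree <
      (X ^ 2 * (X + 50) ^ 3 : R[X]).degree := by
    rw [degree_eq_natDegree hmon.ne_zero, hdeg]
    exact (natDegree_le_iff_degree_le.1 hlow).trans_lt (by norm_num)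
  have heq : quinticU δ q = X ^ 2 * (X + 50) ^ 3 + (quinticU δ q - X ^ 2 * (X + 50) ^ 3) := by ring
  rw [heq]
  exact ⟨hmon.add_of_left hlt, (natDegree_add_eq_left_of_degree_lt hlt).trans hdeg⟩

lemma quinticZ_natDegree {A Δ M : R} (h : 288 * M ^ 2 ≠ 0) : (quinticZ A Δ M).natDegree = 5 := by
  rw [quinticZ]
  compute_degree!

lemma quinticZ_leadingCoeff {A Δ M : R} (h : 288 * M ^ 2 ≠ 0) :
    (quinticZ A Δ M).leadingCoeff = 288 * M ^ 2 := by
  rw [leadingCoeff, quinticZ_natDegree h, quinticZ]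
  simp only [coeff_add, coeff_C_mul, coeff_X_pow, coeff_X, coeff_C]
  norm_num

/-- The substitution `u = 3 z + 1`, `δ = 25 Δ / A²`, `q = A³ / (8 M)` relates the two quintics; here
`A = 1`. -/
lemma aeval_quinticZ_of_quinticU {K L : Type*} [Field K] [Field L] [Algebra K L]
    (h2 : (2 : L) ≠ 0) (h3 : (3 : L) ≠ 0) (h5 : (5 : L) ≠ 0) {δ q : K} (hq : q ≠ 0) (u : L) :
    54 * algebraMap K L q ^ 2 *
      aeval ((u - 1) / 3) (quinticZ 1 (δ / 25) (1 / (8 * q))) = aeval u (quinticU δ q) := by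
  have hq' : algebraMap K L q ≠ 0 := (_root_.map_ne_zero _).2 hq
  have h8 : (8 : L) ≠ 0 := by
    rw [show (8 : L) = 2 ^ 3 by norm_num]; exact pow_ne_zero _ h2
  have h25 : (25 : L) ≠ 0 := by
    rw [show (25 : L) = 5 ^ 2 by norm_num]; exact pow_ne_zero _ h5
  rw [← eval_map_algebraMap, ← eval_map_algebraMap, quinticZ_map, quinticU_map]
  simp only [map_div₀, map_mul, map_one, map_ofNat]
  generalize algebraMap K L q = q at *
  generalize algebraMap K L δ = δ at *
  simp only [quinticZ, quinticU, eval_add, eval_sub, eval_mul, eval_pow, eval_C, eval_X,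
    eval_ofNat]
  field_simp
  ring

lemma quinticU_parametrizes : ParametrizesPerm.{u, v} {2, 3, 5}
    (quinticU (MvPolynomial.X 0) (MvPolynomial.X 1) : (MvPolynomial (Fin 2) ℤ)[X]) 5 := by
  intro K L _ _ _ _ _ e hS
  have hL (p : ℕ) (hp : p ∈ ({2, 3, 5} : Finset ℕ)) : (p : L) ≠ 0 := by
    rw [← map_natCast (algebraMap K L)]
    exact (_root_.map_ne_zero _).2 (hS p hp)
  obtain ⟨δ, q, u, -, hu, hroot, hg⟩ := exists_quinticU_roots e
    (by exact_mod_cast hL 2 (by simp)) (by exact_mod_cast hL 3 (by simp))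
    (by exact_mod_cast hL 5 (by simp))
  refine ⟨![δ, q], u, ?_, hu, fun i ↦ ?_, hg⟩
  · rw [(quinticU_monic_natDegree _ _).1.leadingCoeff, map_one]
    exact one_ne_zero
  · rw [quinticU_map]
    simpa using hroot i

lemma quinticZ_parametrizes : ParametrizesPerm.{u, v} {2, 3, 5}
    (quinticZ (MvPolynomial.X 0) (MvPolynomial.X 1) (MvPolynomial.X 2) :
      (MvPolynomial (Fin 3) ℤ)[X]) 5 := by
  intro K L _ _ _ _ _ e hS
  have hL (p : ℕ) (hp : p ∈ ({2, 3, 5} : Finset ℕ)) : (p : L) ≠ 0 := by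
    rw [← map_natCast (algebraMap K L)]
    exact (_root_.map_ne_zero _).2 (hS p hp)
  have h2 : (2 : L) ≠ 0 := by exact_mod_cast hL 2 (by simp)
  have h3 : (3 : L) ≠ 0 := by exact_mod_cast hL 3 (by simp)
  have h5 : (5 : L) ≠ 0 := by exact_mod_cast hL 5 (by simp)
  have k2 : (2 : K) ≠ 0 := by exact_mod_cast hS 2 (by simp)
  have k3 : (3 : K) ≠ 0 := by exact_mod_cast hS 3 (by simp)
  obtain ⟨δ, q, u, hq, hu, hroot, hg⟩ := exists_quinticU_roots e h2 h3 h5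
  refine ⟨![1, δ / 25, 1 / (8 * q)], fun i ↦ (u i - 1) / 3, ?_, fun i j h ↦ hu ?_, fun i ↦ ?_,
    fun g i ↦ ?_⟩
  · rw [quinticZ_leadingCoeff (by simp [MvPolynomial.X_ne_zero])]
    rw [show (288 : MvPolynomial (Fin 3) ℤ) = 2 ^ 5 * 3 ^ 2 by norm_num]
    simp only [map_mul, map_pow, map_ofNat, MvPolynomial.coe_eval₂Hom, MvPolynomial.eval₂_X]
    refine mul_ne_zero (mul_ne_zero (pow_ne_zero _ k2) (pow_ne_zero _ k3)) (pow_ne_zero _ ?_)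
    refine div_ne_zero one_ne_zero (mul_ne_zero ?_ hq)
    rw [show (8 : K) = 2 ^ 3 by norm_num]
    exact pow_ne_zero _ k2
  · exact sub_left_injective ((div_left_inj' h3).1 h)
  · rw [quinticZ_map]
    have h := (aeval_quinticZ_of_quinticU h2 h3 h5 (δ := δ) hq (u i)).trans (hroot i)
    have hne : 54 * algebraMap K L q ^ 2 ≠ 0 := by
      rw [show (54 : L) = 2 * 3 ^ 3 by norm_num]
      exact mul_ne_zero (mul_ne_zero h2 (pow_ne_zero _ h3))
        (pow_ne_zero _ ((_root_.map_ne_zero _).2 hq))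
    simpa using (mul_eq_zero.1 h).resolve_left hne
  · simp only [map_div₀, map_sub, map_one, map_ofNat, hg]

end Quintics

theorem theorem1 :
    IsGenericOutside.{u, v, 0} {2, 3, 5} (Equiv.Perm (Fin 5))
      (quinticZ (param ℚ (0 : Fin 3)) (param ℚ (1 : Fin 3)) (param ℚ (2 : Fin 3))) ∧
    IsGenericOutside.{u, v, 0} {2, 3, 5} (Equiv.Perm (Fin 5))
      (quinticU (param ℚ (0 : Fin 2)) (param ℚ (1 : Fin 2))) := by
  have hS : ∀ p ∈ ({2, 3, 5} : Finset ℕ), p.Prime := by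
    simp only [Finset.mem_insert, Finset.mem_singleton]
    rintro p (rfl | rfl | rfl) <;> norm_num
  have hX {m : ℕ} (i : Fin m) : intParamHom ℚ m (MvPolynomial.X i) = param ℚ i := by
    simp [intParamHom, param]
  constructor
  · have h := quinticZ_parametrizes.{u, v}.isGenericOutside quinticZ_parametrizes.{0, 0}
      (quinticZ_natDegree (by simp [MvPolynomial.X_ne_zero])) hS
    rwa [quinticZ_map, hX, hX, hX] at h
  · have h := quinticU_parametrizes.{u, v}.isGenericOutside quinticU_parametrizes.{0, 0}
      (quinticU_monic_natDegree _ _).2 hS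
    rwa [quinticU_map, hX, hX] at h
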